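/- **Theorem.** Let $\mathbb T\in\{\mathbb R,\mathbb R_+\}$, let $\mathfrak B$ be a Banach space and $1\le p\le\infty$. Let $L^p_{loc}(\mathbb T,\mathfrak B)$ be the space of (classes of) strongly measurable functions $\varphi:\mathbb T\to\mathfrak B$ with $\varphi|_{\mathbb T_\ell}\in L^p(\mathbb T_\ell,\mathfrak B)$ for every $\ell>0$, where $\mathbb T_\ell:=\mathbb T\cap[-\ell,\ell]$ carries Lebesgue measure, with the topology given by the seminorms $\|\varphi\|_{L^p(\mathbb T_\ell)}$, $\ell>0$, and with the shifts $\sigma(h,\varphi)=\varphi^h$, $\varphi^h(s):=\varphi(s+h)$ ($h\in\mathbb T$). Let $\varphi\in L^p_{loc}(\mathbb T,\mathfrak B)$ be such that 1. $\varphi$ is positively Lagrange stable, i.e. $\{\varphi^h : h\in\mathbb T,\ h\ge 0\}$ is precompact in $L^p_{loc}(\mathbb T,\mathfrak B)$; 2. its $\omega$-limit set $\omega_\varphi:=\{\psi : \varphi^{t_k}\to\psi \text{ in } L^p_{loc}(\mathbb T,\mathfrak B)\text{ for some } t_k\in\mathbb T,\ t_k\to+\infty\}$ is minimal, i.e. it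 is nonempty, closed and invariant, and it has no proper nonempty closed invariant subset (where $M$ is invariant if $\sigma(t,M)=M$ for all $t\in\mathbb T$); 3. the primitive $F(t):=\int_0^t\varphi(s)\,ds$ ($t\in\mathbb T$) is precompact, i.e. $Q:=\overline{F(\mathbb R_+)}$ is a compact subset of $\mathfrak B$. Write $D_\tau(t):=\|\varphi(t+\tau+\cdot)-\varphi(t+\cdot)\|_{L^p([0,1],\mathfrak B)}$, which is $\big(\int_0^1|\varphi(t+\tau+s)-\varphi(t+s)|^p\,ds\big)^{1/p}$ if $p<\infty$. A set $P\subseteq\mathbb T$ is called relatively dense in $\mathbb T$ if there is $l>0$ such that $P\cap[a,a+l]\neq\emptyset$ for all $a\in\mathbb T$. Then the following hold. (a) If $\varphi$ is $S^p$ remotely almost periodic, i.e. for every $\varepsilon>0$ there is a relatively dense set $P\subseteq\mathbb T$ such that for every $\tau\in P$ there is $L>0$ with $D_\tau(t)<\varepsilon$ for all $t\in\mathbb T$, $t\ge L$, then $F$ is positively remotely almost periodic, i.e. $F$ is continuous on $\mathbb T$ and for every $\varepsilon>0$ there is a relatively dense set $P\subseteq\mathbb T$ such that for every $\tau\in P$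 there is $L>0$ with $|F(t+\tau)-F(t)|<\varepsilon$ for all $t\in\mathbb T$, $t\ge L$. (b) Let $\tau>0$. If $\varphi$ is $S^p$ remotely $\tau$-periodic, i.e. $\lim_{t\to+\infty}D_\tau(t)=0$, then $F$ is positively remotely $\tau$-periodic, i.e. $F$ is continuous on $\mathbb T$ and $\lim_{t\to+\infty}|F(t+\tau)-F(t)|=0$. (c) If $\varphi$ is $S^p$ remotely stationary, i.e. $S^p$ remotely $\tau$-periodic for every $\tau>0$, then $F$ is positively remotely stationary, i.e. positively remotely $\tau$-periodic for every $\tau>0$. -/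

import Mathlib

open MeasureTheory Filter Set Topology
open scoped ENNReal

/-- The time axis `𝕋`: the real line `ℝ` or the half-line `ℝ₊ = [0, ∞)`. -/
inductive TimeAxis : Type where
  | line : TimeAxis
  | halfLine : TimeAxis

/-- The time axis as a set of real numbers. -/
def TimeAxis.carrier : TimeAxis → Set ℝ
  | TimeAxis.line => Set.univ
  | TimeAxis.halfLine => Set.Ici 0

theorem TimeAxis.add_mem (T : TimeAxis) {a b : ℝ} (ha : a ∈ T.carrier) (hb : b ∈ T.carrier) :
    a + b ∈ T.carrier := by
  cases T
  · exact Set.mem_univ _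
  · exact add_nonneg (Set.mem_Ici.1 ha) (Set.mem_Ici.1 hb)

/-- The bounded window `𝕋_ℓ`: it is `[-ℓ, ℓ]` for the line and `[0, ℓ]` for the half-line
(`ℓ > 0`). -/
def TimeAxis.window (T : TimeAxis) (l : ℝ) : Set ℝ := T.carrier ∩ Set.Icc (-l) l

/-- Lebesgue measure on the time axis. -/
noncomputable def TimeAxis.measure (T : TimeAxis) : Measure ℝ := volume.restrict T.carrier

theorem map_add_restrict_le {h : ℝ} {A B : Set ℝ}
    (hAB : ∀ s ∈ A, s + h ∈ B) :
    Measure.map (fun s : ℝ => s + h) (volume.restrict A) ≤ volume.restrict B := by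
  have hm : Measurable (fun s : ℝ => s + h) := measurable_id.add_const h
  refine Measure.le_iff.2 fun s hs => ?_
  rw [Measure.map_apply hm hs, Measure.restrict_apply (hm hs), Measure.restrict_apply hs]
  calc volume ((fun s : ℝ => s + h) ⁻¹' s ∩ A)
      ≤ volume ((fun s : ℝ => s + h) ⁻¹' (s ∩ B)) :=
        measure_mono fun x hx => ⟨hx.1, hAB x hx.2⟩
    _ = volume (s ∩ B) := measure_preimage_add_right volume h (s ∩ B)

theorem TimeAxis.quasiMeasurePreserving_add (T : TimeAxis) {h : ℝ} (hh : h ∈ T.carrier) :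
    Measure.QuasiMeasurePreserving (fun s : ℝ => s + h) T.measure T.measure :=
  ⟨measurable_id.add_const h, Measure.absolutelyContinuous_of_le
    (map_add_restrict_le fun _ hs => T.add_mem hs hh)⟩

/-- A subset `P` of the time axis is relatively dense if, for some `l > 0`, every segment
`[a, a + l]` with `a ∈ 𝕋` meets `P`. -/
def IsRelativelyDense (T : TimeAxis) (P : Set ℝ) : Prop :=
  P ⊆ T.carrier ∧ ∃ l : ℝ, 0 < l ∧ ∀ a ∈ T.carrier, (P ∩ Set.Icc a (a + l)).Nonempty

/-- The space `L^p_loc(𝕋, B)`: classes, modulo equality almost everywhere on `𝕋`, of strongly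
measurable functions whose restriction to each window `𝕋_ℓ` lies in `L^p`. -/
def LpLoc (T : TimeAxis) (B : Type*) [NormedAddCommGroup B] (p : ℝ≥0∞) : Type _ :=
  {f : ℝ →ₘ[T.measure] B // ∀ l : ℝ, 0 < l → MemLp f p (volume.restrict (T.window l))}

namespace LpLoc

variable {T : TimeAxis} {B : Type*} [NormedAddCommGroup B] {p : ℝ≥0∞}

/-- A representative of a class; its values outside of `𝕋` are irrelevant. -/
noncomputable def toFun (φ : LpLoc T B p) : ℝ → B := φ.1

/-- The restriction of a class to the window `𝕋_ℓ`, as an element of `L^p(𝕋_ℓ, B)`. -/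
noncomputable def restr (l : {l : ℝ // 0 < l}) (φ : LpLoc T B p) :
    Lp B p (volume.restrict (T.window l)) :=
  (φ.2 l l.2).toLp φ.1

/-- The topology of `L^p_loc(𝕋, B)`, given by the seminorms `φ ↦ ‖φ‖_{L^p(𝕋_ℓ)}`, `ℓ > 0`. -/
noncomputable instance [Fact (1 ≤ p)] : TopologicalSpace (LpLoc T B p) :=
  ⨅ l : {l : ℝ // 0 < l}, TopologicalSpace.induced (restr l) inferInstance

theorem memLp_shift (h : T.carrier) (φ : LpLoc T B p) (l : ℝ) (hl : 0 < l) :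
    MemLp (AEEqFun.compQuasiMeasurePreserving φ.1 (fun s : ℝ => s + (h : ℝ))
      (T.quasiMeasurePreserving_add h.2)) p (volume.restrict (T.window l)) := by
  have hm : Measurable (fun s : ℝ => s + (h : ℝ)) := measurable_id.add_const _
  have hle : Measure.map (fun s : ℝ => s + (h : ℝ)) (volume.restrict (T.window l)) ≤
      volume.restrict (T.window (l + |(h : ℝ)|)) :=
    map_add_restrict_le fun s hs =>
      ⟨T.add_mem hs.1 h.2, by linarith [hs.2.1, neg_abs_le (h : ℝ)],
        by linarith [hs.2.2, le_abs_self (h : ℝ)]⟩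
  have h1 := (φ.2 (l + |(h : ℝ)|) (by positivity)).mono_measure hle
  have h2 : MemLp ((φ.1 : ℝ → B) ∘ fun s : ℝ => s + (h : ℝ)) p
      (volume.restrict (T.window l)) :=
    (memLp_map_measure_iff h1.1 hm.aemeasurable).1 h1
  refine (memLp_congr_ae ?_).2 h2
  exact ae_restrict_of_ae_restrict_of_subset Set.inter_subset_left
    (AEEqFun.coeFn_compQuasiMeasurePreserving φ.1 (T.quasiMeasurePreserving_add h.2))

/-- The shift `σ(h, φ) = φ^h`, `φ^h(s) = φ(s + h)`, for `h ∈ 𝕋`. -/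
noncomputable def shift (h : T.carrier) (φ : LpLoc T B p) : LpLoc T B p :=
  ⟨AEEqFun.compQuasiMeasurePreserving φ.1 (fun s : ℝ => s + (h : ℝ))
    (T.quasiMeasurePreserving_add h.2), memLp_shift h φ⟩

end LpLoc

/-- The point `x` is positively Lagrange stable for the motion `π`: the positive semi-trajectory
`{π(t, x) : t ∈ 𝕋, t ≥ 0}` is precompact. -/
def IsPositivelyLagrangeStable {T : TimeAxis} {X : Type*} [TopologicalSpace X]
    (π : T.carrier → X → X) (x : X) : Prop :=
  IsCompact (closure {y : X | ∃ t : T.carrier, 0 ≤ (t : ℝ) ∧ y = π t x})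

/-- The `ω`-limit set of `x`: all limits of `π(t_k, x)` along sequences `t_k → +∞` in `𝕋`. -/
def omegaLimitSet {T : TimeAxis} {X : Type*} [TopologicalSpace X]
    (π : T.carrier → X → X) (x : X) : Set X :=
  {y : X | ∃ t : ℕ → T.carrier, Tendsto (fun k => (t k : ℝ)) atTop atTop ∧
    Tendsto (fun k => π (t k) x) atTop (𝓝 y)}

/-- `M` is invariant: `π(t, M) = M` for all `t ∈ 𝕋`. -/
def IsInvariantSet {T : TimeAxis} {X : Type*} (π : T.carrier → X → X) (M : Set X) : Prop :=
  ∀ t : T.carrier, π t '' M = M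

/-- `M` is a minimal set: nonempty, closed, invariant, and without proper subsets that are
nonempty, closed and invariant. -/
def IsMinimalSet {T : TimeAxis} {X : Type*} [TopologicalSpace X]
    (π : T.carrier → X → X) (M : Set X) : Prop :=
  M.Nonempty ∧ IsClosed M ∧ IsInvariantSet π M ∧
    ∀ N : Set X, N ⊆ M → N.Nonempty → IsClosed N → IsInvariantSet π N → N = M

section Stepanov

variable {T : TimeAxis} {B : Type*} [NormedAddCommGroup B] {p : ℝ≥0∞}

/-- The distance `(∫₀¹ |φ(t + τ + s) - φ(t + s)|^p ds)^(1/p)` (the essential supremum over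
`s ∈ [0, 1]` if `p = ∞`). -/
noncomputable def stepanovDist (φ : LpLoc T B p) (τ t : ℝ) : ℝ≥0∞ :=
  eLpNorm (fun s : ℝ => φ.toFun (t + τ + s) - φ.toFun (t + s)) p
    (volume.restrict (Set.Icc (0 : ℝ) 1))

/-- `S^p` remote almost periodicity. -/
def IsStepanovRemotelyAlmostPeriodic (φ : LpLoc T B p) : Prop :=
  ∀ ε : ℝ, 0 < ε → ∃ P : Set ℝ, IsRelativelyDense T P ∧
    ∀ τ ∈ P, ∃ L : ℝ, 0 < L ∧ ∀ t ∈ T.carrier, L ≤ t → stepanovDist φ τ t < ENNReal.ofReal ε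

/-- `S^p` remote `τ`-periodicity. -/
def IsStepanovRemotelyPeriodic (φ : LpLoc T B p) (τ : ℝ) : Prop :=
  Tendsto (fun t : ℝ => stepanovDist φ τ t) atTop (𝓝 0)

/-- `S^p` remote stationarity. -/
def IsStepanovRemotelyStationary (φ : LpLoc T B p) : Prop :=
  ∀ τ : ℝ, 0 < τ → IsStepanovRemotelyPeriodic φ τ

end Stepanov

section Remote

variable {B : Type*} [NormedAddCommGroup B]

/-- (Positive) remote almost periodicity of a continuous function on `𝕋`. -/
def IsRemotelyAlmostPeriodic (T : TimeAxis) (f : ℝ → B) : Prop :=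
  ContinuousOn f T.carrier ∧
    ∀ ε : ℝ, 0 < ε → ∃ P : Set ℝ, IsRelativelyDense T P ∧
      ∀ τ ∈ P, ∃ L : ℝ, 0 < L ∧ ∀ t ∈ T.carrier, L ≤ t → ‖f (t + τ) - f t‖ < ε

/-- (Positive) remote `τ`-periodicity of a continuous function on `𝕋`. -/
def IsRemotelyPeriodic (T : TimeAxis) (f : ℝ → B) (τ : ℝ) : Prop :=
  ContinuousOn f T.carrier ∧ Tendsto (fun t : ℝ => ‖f (t + τ) - f t‖) atTop (𝓝 0)

/-- (Positive) remote stationarity of a continuous function on `𝕋`. -/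
def IsRemotelyStationary (T : TimeAxis) (f : ℝ → B) : Prop :=
  ∀ τ : ℝ, 0 < τ → IsRemotelyPeriodic T f τ

end Remote

/-- The primitive `F(t) = ∫₀ᵗ φ(s) ds`, `t ∈ 𝕋`. -/
noncomputable def primitive {T : TimeAxis} {B : Type*} [NormedAddCommGroup B] [NormedSpace ℝ B]
    {p : ℝ≥0∞} (φ : LpLoc T B p) (t : ℝ) : B :=
  ∫ s in (0 : ℝ)..t, φ.toFun s

/-! All three claims reduce to one uniform statement: for each ε there is δ such that every τ ∈ 𝕋
with D_τ < δ eventually satisfies |F(t+τ) - F(t)| < ε eventually. As δ does not depend on τ, the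
same relatively dense set serves F in (a).

Fix a functional f with ‖f‖ ≤ 1 and let S be the supremum of f(∫_a^b ψ) over ψ ∈ ω_φ and a, b ∈ 𝕋,
finite because F is bounded on ℝ₊. Some ψ₀ nearly attains S. By minimality every ψ ∈ ω_φ has shifts
close to ψ₀, so it nearly attains S too; by compactness finitely many intervals [a, b] suffice. For
large t, φ^t is close to ω_φ, so f gains almost S on one of these intervals moved by t. Prolonging
it by τ cannot exceed S by much, so f(F(t+b+τ) - F(t+b)) is small. Smallness of D_τ moves this from
t+b to t, since b is bounded (`exists_forall_eventually_apply_primitive_sub_lt`).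

Compactness of Q - Q turns these one-sided scalar bounds into a norm bound
(`exists_forall_eventually_norm_primitive_sub_lt`). -/

theorem continuous_of_edist_le {X Y Z : Type*} [TopologicalSpace X] [PseudoEMetricSpace Y]
    [PseudoEMetricSpace Z] {r : X → Y} {k : X → Z} (hr : Continuous r) {C : ℝ≥0∞} (hC : C ≠ ∞)
    (h : ∀ x y, edist (k x) (k y) ≤ C * edist (r x) (r y)) : Continuous k := by
  refine continuous_iff_continuousAt.2 fun x => ?_
  have h1 : Tendsto (fun y => edist (r y) (r x)) (𝓝 x) (𝓝 0) :=
    tendsto_iff_edist_tendsto_0.1 hr.continuousAt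
  have h2 : Tendsto (fun y => C * edist (r y) (r x)) (𝓝 x) (𝓝 0) := by
    simpa using ENNReal.Tendsto.const_mul h1 (Or.inr hC)
  exact tendsto_iff_edist_tendsto_0.2
    (tendsto_of_tendsto_of_tendsto_of_le_of_le tendsto_const_nhds h2 (fun _ => zero_le)
      fun y => h y x)

/-! ### The time axis and the filter t → +∞. -/

namespace TimeAxis

theorem measurableSet_carrier (T : TimeAxis) : MeasurableSet T.carrier := by
  cases T
  · exact MeasurableSet.univ
  · exact measurableSet_Ici

theorem mem_of_nonneg (T : TimeAxis) {t : ℝ} (ht : 0 ≤ t) : t ∈ T.carrier := by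
  cases T
  · exact mem_univ _
  · exact ht

theorem ordConnected (T : TimeAxis) : T.carrier.OrdConnected := by
  cases T
  · exact ordConnected_univ
  · exact ordConnected_Ici

theorem window_mono (T : TimeAxis) {k l : ℝ} (h : k ≤ l) : T.window k ⊆ T.window l :=
  inter_subset_inter_right _ (Icc_subset_Icc (neg_le_neg h) h)

theorem uIcc_subset_window (T : TimeAxis) {a b l : ℝ} (ha : a ∈ T.carrier) (hb : b ∈ T.carrier)
    (hal : |a| ≤ l) (hbl : |b| ≤ l) : uIcc a b ⊆ T.window l :=
  subset_inter (T.ordConnected.uIcc_subset ha hb)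
    (ordConnected_Icc.uIcc_subset (abs_le.1 hal) (abs_le.1 hbl))

instance isFiniteMeasure_window (T : TimeAxis) (l : ℝ) :
    IsFiniteMeasure (volume.restrict (T.window l)) :=
  isFiniteMeasure_restrict.2
    ((measure_mono inter_subset_right).trans_lt measure_Icc_lt_top).ne

/-- The filter `t → +∞` on the time axis. -/
def toInfinity (T : TimeAxis) : Filter T.carrier := comap Subtype.val atTop

theorem tendsto_toInfinity (T : TimeAxis) {α : Type*} {l : Filter α} {t : α → T.carrier} :
    Tendsto t l T.toInfinity ↔ Tendsto (fun k => (t k : ℝ)) l atTop :=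
  tendsto_comap_iff

instance neBot_toInfinity (T : TimeAxis) : T.toInfinity.NeBot :=
  comap_neBot fun s hs => by
    obtain ⟨a, ha⟩ := mem_atTop_sets.1 hs
    exact ⟨⟨max a 0, T.mem_of_nonneg (le_max_right _ _)⟩, ha _ (le_max_left _ _)⟩

instance isCountablyGenerated_toInfinity (T : TimeAxis) : T.toInfinity.IsCountablyGenerated := by
  unfold toInfinity; infer_instance

/-- The sum of two elements of the time axis. -/
def add (T : TimeAxis) (s t : T.carrier) : T.carrier := ⟨s + t, T.add_mem s.2 t.2⟩

theorem eventually_toInfinity_iff (T : TimeAxis) {q : ℝ → Prop} :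
    (∀ᶠ t : T.carrier in T.toInfinity, q t) ↔ ∀ᶠ t in atTop, q t := by
  rw [toInfinity, eventually_comap]
  constructor
  · intro h
    filter_upwards [h, eventually_ge_atTop 0] with t ht h0 using ht ⟨t, T.mem_of_nonneg h0⟩ rfl
  · intro h
    filter_upwards [h] with t ht a ha
    rwa [ha]

theorem eventually_nonneg (T : TimeAxis) : ∀ᶠ t : T.carrier in T.toInfinity, 0 ≤ (t : ℝ) :=
  (T.eventually_toInfinity_iff (q := fun t => 0 ≤ t)).2 (eventually_ge_atTop 0)

end TimeAxis

/-! ### ω-limit sets and minimal sets. -/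

section Dynamics

variable {T : TimeAxis} {X : Type*} [TopologicalSpace X] {π : T.carrier → X → X} {x : X}

theorem omegaLimitSet_subset_closure :
    omegaLimitSet π x ⊆ closure {y : X | ∃ t : T.carrier, 0 ≤ (t : ℝ) ∧ y = π t x} := by
  rintro y ⟨t, ht, hy⟩
  exact mem_closure_of_tendsto hy
    ((ht.eventually_ge_atTop 0).mono fun k hk => ⟨t k, hk, rfl⟩)

/-- Otherwise some sequence t_k → +∞ stays outside U, and by compactness a subsequence converges to
an ω-limit point outside U. -/
theorem eventually_mem_of_omegaLimitSet_subset [FirstCountableTopology X]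
    (hx : IsPositivelyLagrangeStable π x) {U : Set X} (hU : IsOpen U)
    (h : omegaLimitSet π x ⊆ U) : ∀ᶠ t in T.toInfinity, π t x ∈ U := by
  by_contra hcon
  have hf : ∃ᶠ t : T.carrier in T.toInfinity, 0 ≤ (t : ℝ) ∧ π t x ∉ U :=
    ((not_eventually.1 hcon).and_eventually T.eventually_nonneg).mono fun t ht => ht.symm
  obtain ⟨t, ht, hn⟩ := exists_seq_forall_of_frequently hf
  obtain ⟨y, -, k, hk, hy⟩ := hx.isSeqCompact (x := fun n => π (t n) x)
    (fun n => subset_closure ⟨t n, (hn n).1, rfl⟩)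
  have hy' : y ∈ omegaLimitSet π x :=
    ⟨t ∘ k, (T.tendsto_toInfinity.1 ht).comp hk.tendsto_atTop, hy⟩
  obtain ⟨n, hnU⟩ := (hy.eventually (hU.mem_nhds (h hy'))).exists
  exact (hn (k n)).2 hnU

theorem isInvariantSet_setOf_mapClusterPt [T2Space X] (hc : ∀ t, Continuous (π t))
    (hadd : ∀ s t, π (T.add s t) x = π t (π s x)) {K : Set X} (hK : IsCompact K)
    (hxK : ∀ t, π t x ∈ K) :
    IsInvariantSet π {z | MapClusterPt z T.toInfinity fun t => π t x} := by
  intro t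
  have hadd_tendsto : Tendsto (fun s => T.add s t) T.toInfinity T.toInfinity :=
    T.tendsto_toInfinity.2 (tendsto_atTop_add_const_right _ _ tendsto_comap)
  apply Subset.antisymm
  · rintro _ ⟨z, hz, rfl⟩
    have h1 : MapClusterPt (π t z) T.toInfinity (π t ∘ fun s => π s x) :=
      hz.continuousAt_comp (hc t).continuousAt
    have h2 : (π t ∘ fun s => π s x) = (fun s => π s x) ∘ fun s => T.add s t :=
      funext fun s => (hadd s t).symm
    rw [h2] at h1
    exact h1.of_comp hadd_tendsto
  · intro z hz
    obtain ⟨U, hU, hUz⟩ := mapClusterPt_iff_ultrafilter.1 hz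
    have hU' : Tendsto (fun s : T.carrier => (s : ℝ)) U atTop := T.tendsto_toInfinity.1 hU
    -- A preimage of z under π t is a limit of the orbit at times s - t. The truncation at 0 keeps
    -- these times in the half-line and is inactive for large s.
    let r : T.carrier → T.carrier := fun s => ⟨max (s - t) 0, T.mem_of_nonneg (le_max_right _ _)⟩
    have hr : Tendsto r U T.toInfinity := T.tendsto_toInfinity.2
      (tendsto_atTop_mono (fun s => le_max_left _ _) (tendsto_atTop_add_const_right _ (-(t : ℝ)) hU'))
    obtain ⟨w, -, hw⟩ := hK.ultrafilter_le_nhds (U.map fun s : T.carrier => π (r s) x)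
      (le_principal_iff.2 (Ultrafilter.mem_map.2 (univ_mem' fun s => hxK (r s))))
    have hw' : Tendsto (fun s => π (r s) x) U (𝓝 w) := hw
    have hwN : MapClusterPt w T.toInfinity fun t => π t x :=
      (hw'.mapClusterPt : MapClusterPt w U ((fun t => π t x) ∘ r)).of_comp hr
    refine ⟨w, hwN, tendsto_nhds_unique (((hc t).tendsto w).comp hw') (hUz.congr' ?_)⟩
    filter_upwards [hU'.eventually_ge_atTop (t : ℝ)] with s hs
    have : T.add (r s) t = s := Subtype.ext (by simp [TimeAxis.add, r, max_eq_left (sub_nonneg.2 hs)])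
    simp only [Function.comp]
    rw [← hadd, this]

/-- The cluster points at +∞ of the motion of y form a nonempty closed invariant subset of M, hence
all of M. -/
theorem IsMinimalSet.mem_closure_semiorbit [T2Space X] {M : Set X} (hM : IsMinimalSet π M)
    (hMc : IsCompact M) (hc : ∀ t, Continuous (π t))
    (hadd : ∀ s t x, π (T.add s t) x = π t (π s x)) {y z : X} (hy : y ∈ M) (hz : z ∈ M) :
    z ∈ closure {w : X | ∃ t : T.carrier, 0 ≤ (t : ℝ) ∧ w = π t y} := by
  obtain ⟨-, hcl, hinv, hmin⟩ := hM
  have hyM : ∀ t, π t y ∈ M := fun t => hinv t ▸ mem_image_of_mem _ hy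
  have hN := hmin {z | MapClusterPt z T.toInfinity fun t => π t y}
    (fun w hw => hcl.closure_eq ▸ mem_closure_iff_clusterPt.2
      (ClusterPt.mono hw (tendsto_principal.2 (Eventually.of_forall hyM))))
    (by
      obtain ⟨w, -, hw⟩ := hMc.exists_mapClusterPt (f := T.toInfinity) (u := fun t => π t y)
        (tendsto_principal.2 (Eventually.of_forall hyM))
      exact ⟨w, hw⟩)
    isClosed_setOfPred_clusterPt
    (isInvariantSet_setOf_mapClusterPt hc (fun s t => hadd s t y) hMc hyM)
  rw [← hN] at hz
  exact mem_closure_iff_clusterPt.2 (ClusterPt.mono hz (le_principal_iff.2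
    (T.eventually_nonneg.mono fun t ht => ⟨t, ht, rfl⟩)))

end Dynamics

/-! ### Shifts, topology and integration on L^p_loc. -/

namespace LpLoc

variable {T : TimeAxis} {B : Type*} [NormedAddCommGroup B] {p : ℝ≥0∞}

theorem stronglyMeasurable_toFun (φ : LpLoc T B p) : StronglyMeasurable φ.toFun :=
  φ.1.stronglyMeasurable

theorem toFun_shift (h : T.carrier) (φ : LpLoc T B p) :
    (shift h φ).toFun =ᵐ[T.measure] fun s => φ.toFun (s + h) :=
  AEEqFun.coeFn_compQuasiMeasurePreserving φ.1 (T.quasiMeasurePreserving_add h.2)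

theorem ext_of_ae {φ ψ : LpLoc T B p} (h : φ.toFun =ᵐ[T.measure] ψ.toFun) : φ = ψ :=
  Subtype.ext (AEEqFun.ext h)

theorem shift_add (s t : T.carrier) (φ : LpLoc T B p) :
    shift (T.add s t) φ = shift t (shift s φ) := by
  refine ext_of_ae ?_
  have h1 := (T.quasiMeasurePreserving_add t.2).ae_eq_comp (toFun_shift s φ)
  filter_upwards [toFun_shift (T.add s t) φ, toFun_shift t (shift s φ), h1] with u h2 h3 h4
  rw [h2, h3]
  simp only [Function.comp] at h4
  rw [h4]
  simp only [TimeAxis.add]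
  congr 1
  ring

theorem edist_restr (l : {l : ℝ // 0 < l}) (φ ψ : LpLoc T B p) :
    edist (restr l φ) (restr l ψ) =
      eLpNorm (φ.toFun - ψ.toFun) p (volume.restrict (T.window l)) :=
  Lp.edist_toLp_toLp _ _ _ _

theorem edist_restr_mono {k l : {l : ℝ // 0 < l}} (h : (k : ℝ) ≤ l) (φ ψ : LpLoc T B p) :
    edist (restr k φ) (restr k ψ) ≤ edist (restr l φ) (restr l ψ) := by
  rw [edist_restr, edist_restr]
  exact eLpNorm_mono_measure _ (Measure.restrict_mono_set _ (T.window_mono h))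

theorem edist_restr_shift_le {k l : {l : ℝ // 0 < l}} (h : T.carrier) (hkl : k + |(h : ℝ)| ≤ l)
    (φ ψ : LpLoc T B p) :
    edist (restr k (shift h φ)) (restr k (shift h ψ)) ≤ edist (restr l φ) (restr l ψ) := by
  have hm : Measurable (fun s : ℝ => s + (h : ℝ)) := measurable_id.add_const _
  have hle : Measure.map (fun s : ℝ => s + (h : ℝ)) (volume.restrict (T.window k)) ≤
      volume.restrict (T.window l) :=
    map_add_restrict_le fun s hs =>
      ⟨T.add_mem hs.1 h.2, by linarith [hs.2.1, neg_abs_le (h : ℝ)],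
        by linarith [hs.2.2, le_abs_self (h : ℝ)]⟩
  have hmeas := φ.stronglyMeasurable_toFun.sub ψ.stronglyMeasurable_toFun
  rw [edist_restr, edist_restr]
  calc eLpNorm ((shift h φ).toFun - (shift h ψ).toFun) p (volume.restrict (T.window k))
      = eLpNorm ((φ.toFun - ψ.toFun) ∘ fun s : ℝ => s + (h : ℝ)) p
          (volume.restrict (T.window k)) := by
        refine eLpNorm_congr_ae ?_
        filter_upwards [ae_restrict_of_ae_restrict_of_subset inter_subset_left (toFun_shift h φ),
          ae_restrict_of_ae_restrict_of_subset inter_subset_left (toFun_shift h ψ)] with s h1 h2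
        simp [h1, h2]
    _ = eLpNorm (φ.toFun - ψ.toFun) p
          (Measure.map (fun s : ℝ => s + (h : ℝ)) (volume.restrict (T.window k))) :=
        (eLpNorm_map_measure hmeas.aestronglyMeasurable hm.aemeasurable).symm
    _ ≤ _ := eLpNorm_mono_measure _ hle

/-- The restrictions of a class to the windows of natural radius. -/
noncomputable def restrSeq (φ : LpLoc T B p) :
    ∀ n : ℕ, Lp B p (volume.restrict (T.window ((⟨n + 1, by positivity⟩ : {l : ℝ // 0 < l}) : ℝ))) :=
  fun _ => restr _ φ

theorem injective_restrSeq : Function.Injective (restrSeq : LpLoc T B p → _) := by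
  intro φ ψ h
  refine ext_of_ae ?_
  have hU : T.carrier = ⋃ n : ℕ, T.window (n + 1) := by
    simp only [TimeAxis.window]
    rw [← inter_iUnion, eq_comm, inter_eq_left]
    intro x _
    obtain ⟨n, hn⟩ := exists_nat_ge |x|
    exact mem_iUnion.2 ⟨n, abs_le.1 (hn.trans (by linarith))⟩
  rw [TimeAxis.measure, hU]
  refine (ae_restrict_iUnion_iff _ _).2 fun n => ?_
  have hn := congrFun h n
  exact (MemLp.toLp_eq_toLp_iff (φ.2 (n + 1) (by positivity)) (ψ.2 (n + 1) (by positivity))).1 hn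

section Topology

variable [Fact (1 ≤ p)]

theorem continuous_restr (l : {l : ℝ // 0 < l}) :
    Continuous (restr l : LpLoc T B p → Lp B p (volume.restrict (T.window l))) :=
  continuous_iInf_dom (i := l) continuous_induced_dom

theorem continuous_of_restr_edist_le {Z : Type*} [PseudoEMetricSpace Z] {k : LpLoc T B p → Z}
    (l : {l : ℝ // 0 < l}) {C : ℝ≥0∞} (hC : C ≠ ∞)
    (h : ∀ φ ψ, edist (k φ) (k ψ) ≤ C * edist (restr l φ) (restr l ψ)) : Continuous k :=
  continuous_of_edist_le (continuous_restr l) hC h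

theorem continuous_shift (h : T.carrier) :
    Continuous (shift h : LpLoc T B p → LpLoc T B p) := by
  refine continuous_iInf_rng.2 fun k => continuous_induced_rng.2 ?_
  refine continuous_of_restr_edist_le ⟨k + |(h : ℝ)|, by have := k.2; positivity⟩
    ENNReal.one_ne_top fun φ ψ => ?_
  rw [one_mul]
  exact edist_restr_shift_le h le_rfl φ ψ

/-- Countably many windows generate the topology, which yields metrizability and thereby the
sequential arguments on ω-limit sets. -/
theorem isInducing_restrSeq : IsInducing (restrSeq : LpLoc T B p → _) := by
  refine ⟨le_antisymm (continuous_iff_le_induced.1 (continuous_pi fun n => continuous_restr _)) ?_⟩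
  refine le_iInf fun l => ?_
  obtain ⟨n, hn⟩ := exists_nat_ge (l : ℝ)
  let k : {l : ℝ // 0 < l} := ⟨n + 1, by positivity⟩
  let _ : TopologicalSpace (LpLoc T B p) :=
    TopologicalSpace.induced restrSeq inferInstance
  have hk : Continuous (restr k : LpLoc T B p → _) :=
    (continuous_apply n).comp (continuous_induced_dom : Continuous restrSeq)
  refine continuous_iff_le_induced.1 (continuous_of_edist_le hk ENNReal.one_ne_top fun φ ψ => ?_)
  rw [one_mul]
  exact edist_restr_mono (hn.trans (by simp [k])) φ ψ

instance metrizableSpace : TopologicalSpace.MetrizableSpace (LpLoc T B p) :=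
  IsEmbedding.metrizableSpace ⟨isInducing_restrSeq, injective_restrSeq⟩

end Topology

section Integral

theorem integrableOn_window [Fact (1 ≤ p)] (φ : LpLoc T B p) (l : ℝ) :
    IntegrableOn φ.toFun (T.window l) := by
  have h : IntegrableOn φ.toFun (T.window (max l 1)) :=
    (φ.2 (max l 1) (by positivity)).integrable Fact.out
  exact h.mono_set (T.window_mono (le_max_left _ _))

theorem intervalIntegrable_toFun [Fact (1 ≤ p)] (φ : LpLoc T B p) {a b : ℝ} (ha : a ∈ T.carrier)
    (hb : b ∈ T.carrier) : IntervalIntegrable φ.toFun volume a b :=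
  intervalIntegrable_iff.2 ((φ.integrableOn_window _).mono_set (uIoc_subset_uIcc.trans
    (T.uIcc_subset_window ha hb (le_max_left |a| |b|) (le_max_right _ _))))

variable [NormedSpace ℝ B]

theorem intervalIntegral_shift (h : T.carrier) (φ : LpLoc T B p) {a b : ℝ} (ha : a ∈ T.carrier)
    (hb : b ∈ T.carrier) :
    ∫ s in a..b, (shift h φ).toFun s = ∫ s in (a + h)..(b + h), φ.toFun s := by
  rw [← intervalIntegral.integral_comp_add_right]
  refine intervalIntegral.integral_congr_ae_restrict ?_
  exact ae_restrict_of_ae_restrict_of_subset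
    (uIoc_subset_uIcc.trans (T.ordConnected.uIcc_subset ha hb)) (toFun_shift h φ)

theorem continuous_intervalIntegral [Fact (1 ≤ p)] {a b : ℝ} (ha : a ∈ T.carrier)
    (hb : b ∈ T.carrier) : Continuous fun φ : LpLoc T B p => ∫ s in a..b, φ.toFun s := by
  let l : {l : ℝ // 0 < l} := ⟨max (max |a| |b|) 1, by positivity⟩
  have hsub : uIoc a b ⊆ T.window l := uIoc_subset_uIcc.trans (T.uIcc_subset_window ha hb
    ((le_max_left _ _).trans (le_max_left _ _)) ((le_max_right _ _).trans (le_max_left _ _)))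
  -- C is the Hölder constant from L^p to L^1 on the window. For p = ∞ the convention `∞.toReal = 0`
  -- gives the correct exponent 1.
  refine continuous_of_restr_edist_le l
    (C := volume.restrict (T.window l) univ ^ (1 / (1 : ℝ≥0∞).toReal - 1 / p.toReal))
    (ENNReal.rpow_ne_top_of_nonneg ?_ (measure_ne_top _ _)) fun φ ψ => ?_
  · have hp : (1 : ℝ≥0∞) ≤ p := Fact.out
    rcases eq_or_ne p ∞ with rfl | hp'
    · simp
    · have : 1 ≤ p.toReal := by simpa using ENNReal.toReal_mono hp' hp
      simpa using inv_le_one_of_one_le₀ this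
  · rw [edist_restr, edist_eq_enorm_sub, ← intervalIntegral.integral_sub
      (φ.intervalIntegrable_toFun ha hb) (ψ.intervalIntegrable_toFun ha hb)]
    calc ‖∫ s in a..b, (φ.toFun s - ψ.toFun s)‖ₑ
        = ‖∫ s in uIoc a b, (φ.toFun s - ψ.toFun s)‖ₑ := by
          simp only [← ofReal_norm]
          rw [intervalIntegral.norm_intervalIntegral_eq]
      _ ≤ ∫⁻ s in uIoc a b, ‖φ.toFun s - ψ.toFun s‖ₑ := enorm_integral_le_lintegral_enorm _
      _ ≤ ∫⁻ s in T.window l, ‖φ.toFun s - ψ.toFun s‖ₑ := lintegral_mono_set hsub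
      _ = eLpNorm (φ.toFun - ψ.toFun) 1 (volume.restrict (T.window l)) := by
          rw [eLpNorm_one_eq_lintegral_enorm]; rfl
      _ ≤ _ := by
          rw [mul_comm]
          exact eLpNorm_le_eLpNorm_mul_rpow_measure_univ Fact.out
            (φ.stronglyMeasurable_toFun.sub ψ.stronglyMeasurable_toFun).aestronglyMeasurable

theorem primitive_sub_primitive [Fact (1 ≤ p)] (φ : LpLoc T B p) {a b : ℝ} (ha : a ∈ T.carrier)
    (hb : b ∈ T.carrier) : primitive φ b - primitive φ a = ∫ s in a..b, φ.toFun s :=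
  intervalIntegral.integral_interval_sub_left
    (φ.intervalIntegrable_toFun (T.mem_of_nonneg le_rfl) hb)
    (φ.intervalIntegrable_toFun (T.mem_of_nonneg le_rfl) ha)

theorem continuousOn_primitive [Fact (1 ≤ p)] (φ : LpLoc T B p) :
    ContinuousOn (primitive φ) T.carrier := by
  -- On the half-line the representative is uncontrolled at negative times, so it is extended by
  -- zero.
  have hint : ∀ a b, IntervalIntegrable (T.carrier.indicator φ.toFun) volume a b := fun a b => by
    rw [intervalIntegrable_iff, IntegrableOn,
      integrable_indicator_iff T.measurableSet_carrier, IntegrableOn,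
      Measure.restrict_restrict T.measurableSet_carrier]
    exact (φ.integrableOn_window (max |a| |b|)).mono_set (inter_subset_inter_right _
      (uIoc_subset_uIcc.trans (ordConnected_Icc.uIcc_subset
        (abs_le.1 (le_max_left _ _)) (abs_le.1 (le_max_right _ _)))))
  refine (intervalIntegral.continuous_primitive hint 0).continuousOn.congr fun t ht => ?_
  refine intervalIntegral.integral_congr fun s hs => ?_
  rw [indicator_of_mem (T.ordConnected.uIcc_subset (T.mem_of_nonneg le_rfl) ht hs)]

end Integral

end LpLoc

/-! ### Increments of the primitive and the main estimates. -/

namespace LpLoc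

variable {T : TimeAxis} {B : Type*} [NormedAddCommGroup B] {p : ℝ≥0∞} [Fact (1 ≤ p)]

theorem lintegral_enorm_sub_le_stepanovDist (φ : LpLoc T B p) (τ a : ℝ) :
    ∫⁻ u in Ico a (a + 1), ‖φ.toFun (u + τ) - φ.toFun u‖ₑ ≤ stepanovDist φ τ a := by
  have hprob : IsProbabilityMeasure (volume.restrict (Icc (0 : ℝ) 1)) := ⟨by simp⟩
  have hmeas : StronglyMeasurable fun s : ℝ => φ.toFun (a + τ + s) - φ.toFun (a + s) :=
    (φ.stronglyMeasurable_toFun.comp_measurable (measurable_const_add _)).sub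
      (φ.stronglyMeasurable_toFun.comp_measurable (measurable_const_add _))
  have himg : (fun s : ℝ => a + s) ⁻¹' Icc a (a + 1) = Icc 0 1 := by
    simp
  calc ∫⁻ u in Ico a (a + 1), ‖φ.toFun (u + τ) - φ.toFun u‖ₑ
      ≤ ∫⁻ u in Icc a (a + 1), ‖φ.toFun (u + τ) - φ.toFun u‖ₑ :=
        lintegral_mono_set Ico_subset_Icc_self
    _ = ∫⁻ s in Icc 0 1, ‖φ.toFun (a + s + τ) - φ.toFun (a + s)‖ₑ := by
        rw [← himg]
        exact ((measurePreserving_add_left volume a).setLIntegral_comp_preimage_emb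
          (measurableEmbedding_addLeft a) _ _).symm
    _ = eLpNorm (fun s : ℝ => φ.toFun (a + τ + s) - φ.toFun (a + s)) 1
          (volume.restrict (Icc 0 1)) := by
        simp only [eLpNorm_one_eq_lintegral_enorm, add_right_comm a]
    _ ≤ _ := eLpNorm_le_eLpNorm_of_exponent_le Fact.out hmeas.aestronglyMeasurable

theorem lintegral_enorm_sub_le_nsmul (φ : LpLoc T B p) {τ L : ℝ} {δ : ℝ≥0∞}
    (h : ∀ t, L ≤ t → stepanovDist φ τ t ≤ δ) {a : ℝ} (ha : L ≤ a) (n : ℕ) :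
    ∫⁻ u in Ico a (a + n), ‖φ.toFun (u + τ) - φ.toFun u‖ₑ ≤ n * δ := by
  induction n with
  | zero => simp
  | succ n ih =>
    have hn : (0 : ℝ) ≤ n := n.cast_nonneg
    have hU : Ico a (a + (n + 1 : ℕ)) = Ico a (a + n) ∪ Ico (a + n) (a + n + 1) := by
      rw [Ico_union_Ico_eq_Ico (by linarith) (by linarith)]
      push_cast
      rw [add_assoc]
    rw [hU]
    refine (lintegral_union_le _ _ _).trans ?_
    rw [Nat.cast_succ, add_mul, one_mul]
    exact add_le_add ih
      ((φ.lintegral_enorm_sub_le_stepanovDist τ (a + n)).trans (h _ (by linarith)))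

variable [NormedSpace ℝ B]

/-- The two increments differ by the integral of φ(u+τ) - φ(u) between t and t + c, which lies in
[t-n, t+n): 2n unit windows, all beyond L. -/
theorem norm_primitive_sub_sub_le (φ : LpLoc T B p) {τ L δ : ℝ} (hδ : 0 ≤ δ)
    (hτ : τ ∈ T.carrier) (h : ∀ t, L ≤ t → stepanovDist φ τ t ≤ ENNReal.ofReal δ)
    {t c : ℝ} {n : ℕ} (ht : t ∈ T.carrier) (htc : t + c ∈ T.carrier) (hc : |c| < n)
    (hL : L + n ≤ t) :
    ‖(primitive φ (t + c + τ) - primitive φ (t + c)) - (primitive φ (t + τ) - primitive φ t)‖ ≤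
      2 * n * δ := by
  have hi : IntervalIntegrable (fun u => φ.toFun (u + τ)) volume t (t + c) := by
    simpa using (φ.intervalIntegrable_toFun (T.add_mem ht hτ) (T.add_mem htc hτ)).comp_add_right τ
  have heq : (primitive φ (t + c + τ) - primitive φ (t + c)) -
      (primitive φ (t + τ) - primitive φ t) =
        ∫ u in t..(t + c), (φ.toFun (u + τ) - φ.toFun u) := by
    rw [intervalIntegral.integral_sub hi (φ.intervalIntegrable_toFun ht htc),
      intervalIntegral.integral_comp_add_right, ← φ.primitive_sub_primitive ht htc,
      ← φ.primitive_sub_primitive (T.add_mem ht hτ) (T.add_mem htc hτ)]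
    abel
  have hsub : uIoc t (t + c) ⊆ Ico (t - n) (t - n + (2 * n : ℕ)) := by
    have := abs_lt.1 hc
    refine uIoc_subset_uIcc.trans (ordConnected_Ico.uIcc_subset ⟨?_, ?_⟩ ⟨?_, ?_⟩) <;>
      push_cast <;> linarith
  rw [heq, intervalIntegral.norm_intervalIntegral_eq,
    ← ENNReal.ofReal_le_ofReal_iff (by positivity), ofReal_norm]
  calc ‖∫ u in uIoc t (t + c), (φ.toFun (u + τ) - φ.toFun u)‖ₑ
      ≤ ∫⁻ u in uIoc t (t + c), ‖φ.toFun (u + τ) - φ.toFun u‖ₑ :=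
        enorm_integral_le_lintegral_enorm _
    _ ≤ ∫⁻ u in Ico (t - n) (t - n + (2 * n : ℕ)), ‖φ.toFun (u + τ) - φ.toFun u‖ₑ :=
        lintegral_mono_set hsub
    _ ≤ (2 * n : ℕ) * ENNReal.ofReal δ :=
        φ.lintegral_enorm_sub_le_nsmul h (by linarith) _
    _ = ENNReal.ofReal (2 * n * δ) := by
        rw [ENNReal.ofReal_mul (by positivity)]
        congr 1
        rw [← ENNReal.ofReal_natCast]
        push_cast
        rfl

/-- For large k the integral of φ^{t_k} is a difference of two values of F at nonnegative times; the
bound passes to the limit. -/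
theorem norm_intervalIntegral_le_of_mem_omegaLimitSet {φ : LpLoc T B p} {C : ℝ}
    (hC : ∀ t, 0 ≤ t → ‖primitive φ t‖ ≤ C) {ψ : LpLoc T B p}
    (hψ : ψ ∈ omegaLimitSet shift φ) {a b : ℝ} (ha : a ∈ T.carrier) (hb : b ∈ T.carrier) :
    ‖∫ s in a..b, ψ.toFun s‖ ≤ C + C := by
  obtain ⟨t, ht, hψt⟩ := hψ
  have hcont : Continuous fun χ : LpLoc T B p => ‖∫ s in a..b, χ.toFun s‖ :=
    (continuous_intervalIntegral ha hb).norm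
  refine le_of_tendsto ((hcont.tendsto ψ).comp hψt) ?_
  filter_upwards [(tendsto_atTop_add_const_left _ a ht).eventually_ge_atTop 0,
    (tendsto_atTop_add_const_left _ b ht).eventually_ge_atTop 0] with k h1 h2
  simp only [Function.comp]
  rw [intervalIntegral_shift _ _ ha hb,
    ← φ.primitive_sub_primitive (T.add_mem ha (t k).2) (T.add_mem hb (t k).2)]
  exact (norm_sub_le _ _).trans (add_le_add (hC _ h2) (hC _ h1))

/-- The extremal argument: an increment of f ∘ F that is already almost maximal cannot grow much
when its interval is prolonged by τ. -/
theorem exists_forall_eventually_apply_primitive_sub_lt {φ : LpLoc T B p}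
    (hstable : IsPositivelyLagrangeStable shift φ)
    (hmin : IsMinimalSet shift (omegaLimitSet shift φ)) {C : ℝ}
    (hC : ∀ t, 0 ≤ t → ‖primitive φ t‖ ≤ C) {f : B →L[ℝ] ℝ} (hf : ‖f‖ ≤ 1) {η : ℝ}
    (hη : 0 < η) :
    ∃ δ : ℝ, 0 < δ ∧ ∀ τ ∈ T.carrier,
      (∀ᶠ t in atTop, stepanovDist φ τ t < ENNReal.ofReal δ) →
        ∀ᶠ t in atTop, f (primitive φ (t + τ) - primitive φ t) < η := by
  have hfle : ∀ v, f v ≤ ‖v‖ := fun v =>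
    (le_abs_self _).trans ((f.le_of_opNorm_le hf v).trans (one_mul _).le)
  have hcomp : IsCompact (omegaLimitSet shift φ) :=
    hstable.of_isClosed_subset hmin.2.1 omegaLimitSet_subset_closure
  let A : T.carrier → T.carrier → LpLoc T B p → ℝ := fun a b ψ =>
    f (∫ s in (a : ℝ)..b, ψ.toFun s)
  have hA : ∀ a b, Continuous (A a b) := fun a b =>
    f.continuous.comp (continuous_intervalIntegral a.2 b.2)
  have hAshift : ∀ a b t ψ, A a b (shift t ψ) = A (T.add a t) (T.add b t) ψ := fun a b t ψ =>
    congrArg f (intervalIntegral_shift t ψ a.2 b.2)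
  have hAφ : ∀ a b, A a b φ = f (primitive φ b - primitive φ a) := fun a b => by
    rw [φ.primitive_sub_primitive a.2 b.2]
  let V : Set ℝ := {r | ∃ ψ ∈ omegaLimitSet shift φ, ∃ a b, r = A a b ψ}
  have hV : BddAbove V := by
    refine ⟨C + C, ?_⟩
    rintro _ ⟨ψ, hψ, a, b, rfl⟩
    exact (hfle _).trans (norm_intervalIntegral_le_of_mem_omegaLimitSet hC hψ a.2 b.2)
  have hVne : V.Nonempty := by
    obtain ⟨ψ, hψ⟩ := hmin.1
    exact ⟨_, ψ, hψ, ⟨0, T.mem_of_nonneg le_rfl⟩, ⟨0, T.mem_of_nonneg le_rfl⟩, rfl⟩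
  obtain ⟨_, ⟨ψ₀, hψ₀, a₀, b₀, rfl⟩, hlt⟩ :=
    exists_lt_of_lt_csSup hVne (show sSup V - η / 4 < sSup V by linarith)
  let U : T.carrier × T.carrier → Set (LpLoc T B p) := fun q =>
    {ψ | sSup V - η / 4 < A q.1 q.2 ψ}
  have hU : ∀ q, IsOpen (U q) := fun q => isOpen_lt continuous_const (hA _ _)
  -- By minimality some shift ψ^t nearly attains the supremum on [a₀, b₀], so ψ does on [a₀+t,
  -- b₀+t].
  have hcover : omegaLimitSet shift φ ⊆ ⋃ q, U q := by
    intro ψ hψ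
    obtain ⟨_, hw, t, -, rfl⟩ := mem_closure_iff.1
      (hmin.mem_closure_semiorbit hcomp continuous_shift shift_add hψ hψ₀) _ (hU (a₀, b₀)) hlt
    refine mem_iUnion.2 ⟨(T.add a₀ t, T.add b₀ t), ?_⟩
    simpa only [U, mem_ofPred_eq, hAshift] using hw
  obtain ⟨J, hJ⟩ := hcomp.elim_finite_subcover U hU hcover
  obtain ⟨M, hM⟩ := (J.image fun q => |(q.2 : ℝ)|).bddAbove
  obtain ⟨n, hn⟩ := exists_nat_gt (max M 0)
  have hn0 : (0 : ℝ) < n := (le_max_right _ _).trans_lt hn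
  -- Here n exceeds every |b| in the finite subcover, so moving the increment from t + b to t costs
  -- at most 2nδ = η/4. Both are chosen before τ.
  refine ⟨η / (8 * n), by positivity, fun τ hτ hτδ => ?_⟩
  obtain ⟨L, hL⟩ := eventually_atTop.1 hτδ
  have hE1 := eventually_mem_of_omegaLimitSet_subset hstable
    (isOpen_biUnion fun q (_ : q ∈ J) => hU q) hJ
  -- The upper bound on the prolonged intervals [a, b+τ]; finiteness of J makes it hold for all of
  -- them simultaneously.
  have hE2 : ∀ᶠ t in T.toInfinity,
      ∀ q ∈ J, shift t φ ∈ {ψ | A q.1 (T.add q.2 ⟨τ, hτ⟩) ψ < sSup V + η / 4} := by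
    refine (Finset.eventually_all J).2 fun q _ => eventually_mem_of_omegaLimitSet_subset hstable
      (isOpen_lt (hA _ _) continuous_const) fun ψ hψ => ?_
    have : A q.1 (T.add q.2 ⟨τ, hτ⟩) ψ ≤ sSup V := le_csSup hV ⟨ψ, hψ, _, _, rfl⟩
    simp only [mem_ofPred_eq]
    linarith
  refine (T.eventually_toInfinity_iff
    (q := fun t => f (primitive φ (t + τ) - primitive φ t) < η)).1 ?_
  filter_upwards [hE1, hE2, (T.eventually_toInfinity_iff (q := fun t => L + n ≤ t)).2
    (eventually_ge_atTop _)] with t h1 h2 h3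
  obtain ⟨q, hq, hqt⟩ := mem_iUnion₂.1 h1
  have h2 := h2 q hq
  simp only [U, mem_ofPred_eq, hAshift, hAφ, map_sub, TimeAxis.add] at h2 hqt
  have hqn : |(q.2 : ℝ)| < n :=
    (hM (Finset.mem_coe.2 (Finset.mem_image_of_mem _ hq))).trans_lt ((le_max_left _ _).trans_lt hn)
  have h4 := φ.norm_primitive_sub_sub_le (by positivity) hτ (fun t ht => (hL t ht).le) t.2
    (T.add_mem t.2 q.2.2) hqn h3
  have h5 := hfle (-((primitive φ (t + q.2 + τ) - primitive φ (t + q.2)) -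
    (primitive φ (t + τ) - primitive φ t)))
  rw [norm_neg] at h5
  have h6 : 2 * (n : ℝ) * (η / (8 * n)) = η / 4 := by field_simp; norm_num
  have e1 : (q.2 : ℝ) + τ + t = t + q.2 + τ := by ring
  have e2 : (q.2 : ℝ) + t = t + q.2 := by ring
  rw [e1] at h2
  rw [e2] at hqt
  simp only [map_sub, map_neg] at h5 ⊢
  -- The losses are η/4 below the supremum, η/4 above it and η/4 for the move: 3η/4 < η.
  linarith

theorem exists_forall_eventually_norm_primitive_sub_lt {φ : LpLoc T B p}
    (hstable : IsPositivelyLagrangeStable shift φ)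
    (hmin : IsMinimalSet shift (omegaLimitSet shift φ))
    (hprimitive : IsCompact (closure (primitive φ '' Ici 0))) {ε : ℝ} (hε : 0 < ε) :
    ∃ δ : ℝ, 0 < δ ∧ ∀ τ ∈ T.carrier,
      (∀ᶠ t in atTop, stepanovDist φ τ t < ENNReal.ofReal δ) →
        ∀ᶠ t in atTop, ‖primitive φ (t + τ) - primitive φ t‖ < ε := by
  have hmem : ∀ t, 0 ≤ t → primitive φ t ∈ closure (primitive φ '' Ici 0) := fun t ht =>
    subset_closure (mem_image_of_mem _ ht)
  obtain ⟨C, hC⟩ := hprimitive.isBounded.exists_norm_le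
  -- K collects the differences in Q - Q of norm at least ε; the increments of F must eventually
  -- avoid it.
  let K : Set B := (fun q : B × B => q.1 - q.2) ''
    (closure (primitive φ '' Ici 0) ×ˢ closure (primitive φ '' Ici 0)) ∩ {v | ε ≤ ‖v‖}
  have hK : IsCompact K :=
    ((hprimitive.prod hprimitive).image (continuous_fst.sub continuous_snd)).inter_right
      (isClosed_le continuous_const continuous_norm)
  have key : ∃ δ : ℝ, 0 < δ ∧ ∀ τ ∈ T.carrier,
      (∀ᶠ t in atTop, stepanovDist φ τ t < ENNReal.ofReal δ) →
        ∀ᶠ t in atTop, primitive φ (t + τ) - primitive φ t ∉ K := by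
    refine hK.induction_on (p := fun S => ∃ δ : ℝ, 0 < δ ∧ ∀ τ ∈ T.carrier,
      (∀ᶠ t in atTop, stepanovDist φ τ t < ENNReal.ofReal δ) →
        ∀ᶠ t in atTop, primitive φ (t + τ) - primitive φ t ∉ S) ?_ ?_ ?_ ?_
    · exact ⟨1, one_pos, fun τ _ _ => Eventually.of_forall fun t => notMem_empty _⟩
    · rintro S S' hS ⟨δ, hδ, h⟩
      exact ⟨δ, hδ, fun τ hτ hτδ => (h τ hτ hτδ).mono fun t ht hts => ht (hS hts)⟩
    · rintro S S' ⟨δ, hδ, h⟩ ⟨δ', hδ', h'⟩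
      refine ⟨min δ δ', lt_min hδ hδ', fun τ hτ hτδ => ?_⟩
      filter_upwards [
        h τ hτ (hτδ.mono fun t ht => ht.trans_le (ENNReal.ofReal_le_ofReal (min_le_left _ _))),
        h' τ hτ (hτδ.mono fun t ht => ht.trans_le (ENNReal.ofReal_le_ofReal (min_le_right _ _)))]
        with t h1 h2 h3
      exact h3.elim h1 h2
    -- A norming functional of v has value at least ε there, so f > ε/2 defines a neighbourhood that
    -- the scalar estimate excludes.
    · rintro v ⟨-, hv⟩
      obtain ⟨f, hf, hfv⟩ := exists_dual_vector'' ℝ v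
      have hfv' : f v = ‖v‖ := hfv
      obtain ⟨δ, hδ, h⟩ := exists_forall_eventually_apply_primitive_sub_lt hstable hmin
        (fun t ht => hC _ (hmem t ht)) hf (half_pos hε)
      refine ⟨{w | ε / 2 < f w}, mem_nhdsWithin_of_mem_nhds
        ((isOpen_lt continuous_const f.continuous).mem_nhds ?_), δ, hδ, fun τ hτ hτδ => ?_⟩
      · have : ε ≤ ‖v‖ := hv
        simp only [mem_ofPred_eq]
        linarith
      · exact (h τ hτ hτδ).mono fun t ht => not_lt.2 ht.le
  obtain ⟨δ, hδ, h⟩ := key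
  refine ⟨δ, hδ, fun τ hτ hτδ => ?_⟩
  -- On the line τ may be negative; t ≥ -τ keeps F(t+τ) in Q.
  filter_upwards [h τ hτ hτδ, eventually_ge_atTop 0, eventually_ge_atTop (-τ)] with t h1 h2 h3
  by_contra hcon
  exact h1 ⟨⟨(primitive φ (t + τ), primitive φ t), ⟨hmem _ (by linarith), hmem _ h2⟩, rfl⟩,
    not_lt.1 hcon⟩

theorem isRemotelyPeriodic_primitive {φ : LpLoc T B p}
    (hstable : IsPositivelyLagrangeStable shift φ)
    (hmin : IsMinimalSet shift (omegaLimitSet shift φ))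
    (hprimitive : IsCompact (closure (primitive φ '' Ici 0))) {τ : ℝ} (hτ : 0 < τ)
    (h : IsStepanovRemotelyPeriodic φ τ) : IsRemotelyPeriodic T (primitive φ) τ := by
  refine ⟨φ.continuousOn_primitive, Metric.tendsto_nhds.2 fun ε hε => ?_⟩
  obtain ⟨δ, hδ, hδτ⟩ :=
    exists_forall_eventually_norm_primitive_sub_lt hstable hmin hprimitive hε
  refine (hδτ τ (T.mem_of_nonneg hτ.le)
    (h.eventually_lt_const (ENNReal.ofReal_pos.2 hδ))).mono fun t ht => ?_
  simpa using ht

theorem isRemotelyAlmostPeriodic_primitive {φ : LpLoc T B p}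
    (hstable : IsPositivelyLagrangeStable shift φ)
    (hmin : IsMinimalSet shift (omegaLimitSet shift φ))
    (hprimitive : IsCompact (closure (primitive φ '' Ici 0)))
    (h : IsStepanovRemotelyAlmostPeriodic φ) : IsRemotelyAlmostPeriodic T (primitive φ) := by
  refine ⟨φ.continuousOn_primitive, fun ε hε => ?_⟩
  obtain ⟨δ, hδ, hδP⟩ :=
    exists_forall_eventually_norm_primitive_sub_lt hstable hmin hprimitive hε
  obtain ⟨P, hP, hPτ⟩ := h δ hδ
  refine ⟨P, hP, fun τ hτ => ?_⟩
  obtain ⟨L, hL0, hL⟩ := hPτ τ hτ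
  obtain ⟨L', hL'⟩ := eventually_atTop.1 (hδP τ (hP.1 hτ) (eventually_atTop.2
    ⟨L, fun t ht => hL t (T.mem_of_nonneg (hL0.le.trans ht)) ht⟩))
  exact ⟨max L' 1, by positivity, fun t _ ht => hL' t ((le_max_left _ _).trans ht)⟩

end LpLoc

theorem theorem3p7 (T : TimeAxis) {B : Type*} [NormedAddCommGroup B] [NormedSpace ℝ B]
    [CompleteSpace B] (p : ℝ≥0∞) [Fact (1 ≤ p)] (φ : LpLoc T B p)
    (hstable : IsPositivelyLagrangeStable LpLoc.shift φ)
    (hmin : IsMinimalSet LpLoc.shift (omegaLimitSet LpLoc.shift φ))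
    (hprimitive : IsCompact (closure (primitive φ '' Set.Ici 0))) :
    (IsStepanovRemotelyAlmostPeriodic φ → IsRemotelyAlmostPeriodic T (primitive φ)) ∧
    (∀ τ : ℝ, 0 < τ → IsStepanovRemotelyPeriodic φ τ → IsRemotelyPeriodic T (primitive φ) τ) ∧
    (IsStepanovRemotelyStationary φ → IsRemotelyStationary T (primitive φ)) :=
  ⟨LpLoc.isRemotelyAlmostPeriodic_primitive hstable hmin hprimitive,
    fun _ hτ => LpLoc.isRemotelyPeriodic_primitive hstable hmin hprimitive hτ,
    fun h τ hτ => LpLoc.isRemotelyPeriodic_primitive hstable hmin hprimitive hτ (h τ hτ)⟩
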